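/- Let $\mathfrak{g}$ be a compact Lie algebra, i.e. a finite-dimensional real Lie algebra with an $\operatorname{ad}$-invariant inner product $\langle\cdot,\cdot\rangle$ (equivalently, the Lie algebra of a compact connected Lie group). Let $\sigma$ be an automorphism of $\mathfrak{g}$ with $\sigma^2=1$ that preserves $\langle\cdot,\cdot\rangle$, and let $a\in\mathfrak{g}$ satisfy $\sigma(a)=-a$. For $x\in\mathfrak{g}$ and a subspace $V\subset\mathfrak{g}$ put $V^x=\{z\in V:[x,z]=0\}$. Put $\mathfrak{k}=\mathfrak{g}^a$ and $\mathfrak{m}=\mathfrak{k}^{\perp}$, let $\tilde{\mathfrak{g}},\tilde{\mathfrak{k}},\tilde{\mathfrak{m}}$ be the sets of fixed points of $\sigma$ in $\mathfrak{g},\mathfrak{k},\mathfrak{m}$, and put $\mathfrak{k}'=(1-\sigma)\mathfrak{k}$. Define $$R(\mathfrak{m})=\{x\in\mathfrak{m}:\dim\mathfrak{g}^x=q(\mathfrak{m}),\ \dim\mathfrak{k}^x=p(\mathfrak{m})\},\qquad q(\mathfrak{m})=\min_{y\in\mathfrak{m}}\dim\mathfrak{g}^y,\quad p(\mathfrak{m})=\min_{y\in\mathfrak{m}}\dim\mathfrak{k}^y,$$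 and define $R(\tilde{\mathfrak{m}})\subset\tilde{\mathfrak{m}}$ in the same way, with $(\mathfrak{g},\mathfrak{k},\mathfrak{m})$ replaced by $(\tilde{\mathfrak{g}},\tilde{\mathfrak{k}},\tilde{\mathfrak{m}})$. Put $r(\mathfrak{m})=q(\mathfrak{m})-p(\mathfrak{m})$ and $\mathfrak{m}(x)=\{y\in\mathfrak{m}:[x,y]\in\mathfrak{m}\}$ for $x\in\mathfrak{m}$. Let $B_x^{\mathrm{si}}$ be the complex bilinear form on the complexification $\mathfrak{m}^{\mathbb{C}}(x)$ of $\mathfrak{m}(x)$ that extends $(y_1,y_2)\mapsto-\langle a,[y_1,y_2]\rangle$, and put $$Q_a(\mathfrak{m})=\{x\in R(\mathfrak{m}):\dim_{\mathbb{C}}\ker B_x^{\mathrm{si}}=r(\mathfrak{m})\}.$$ An element $\alpha\in\mathfrak{k}$ is called regular in $\mathfrak{k}$ if $\dim\mathfrak{k}^{\alpha}=\operatorname{rank}\mathfrak{k}$. **Proposition 2.10.** Suppose that $R(\mathfrak{m})\cap\tilde{\mathfrak{m}}\neq\emptyset$, let $x_0\in R(\mathfrak{m})\cap R(\tilde{\mathfrak{m}})$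 be arbitrary, and suppose that $\mathfrak{k}^{x_0}$ is the center $\mathfrak{z}(\mathfrak{g})$ of $\mathfrak{g}$. Then $Q_a(\mathfrak{m})\cap\tilde{\mathfrak{m}}\neq\emptyset$ if and only if the subspace $\mathfrak{k}'=(1-\sigma)\mathfrak{k}$ contains regular elements of the Lie algebra $\mathfrak{k}$. -/

import Mathlib

namespace Suborbit

noncomputable section

open Module

variable {g : Type*} [LieRing g] [LieAlgebra ℝ g]

/-- The centralizer `𝔤^x = {z ∈ 𝔤 : [x, z] = 0}`, as a Lie subalgebra of `𝔤`. -/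
def centralizer (x : g) : LieSubalgebra ℝ g where
  carrier := {z | ⁅x, z⁆ = 0}
  add_mem' := by
    intro y z hy hz
    have hy' : ⁅x, y⁆ = 0 := hy
    have hz' : ⁅x, z⁆ = 0 := hz
    change ⁅x, y + z⁆ = 0
    rw [lie_add, hy', hz', add_zero]
  zero_mem' := lie_zero x
  smul_mem' := by
    intro c z hz
    have hz' : ⁅x, z⁆ = 0 := hz
    change ⁅x, c • z⁆ = 0
    rw [lie_smul, hz', smul_zero]
  lie_mem' := by
    intro y z hy hz
    have hy' : ⁅x, y⁆ = 0 := hy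
    have hz' : ⁅x, z⁆ = 0 := hz
    change ⁅x, ⁅y, z⁆⁆ = 0
    rw [leibniz_lie, hy', hz', zero_lie, lie_zero, add_zero]

/-- `V^x = V ∩ 𝔤^x`, for a linear subspace `V` of `𝔤`. -/
def centralizerIn (V : Submodule ℝ g) (x : g) : Submodule ℝ g :=
  V ⊓ (centralizer x).toSubmodule

/-- The minimum of `dim V^y` over all `y ∈ p` (the set of values is nonempty, as `0 ∈ p`).
For the pair `(𝔥, 𝔩)` with complement `p`, this is `q(p)` when `V = 𝔥`, and `p(p)` when `V = 𝔩`. -/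
def minDim (V p : Submodule ℝ g) : ℕ :=
  ⨅ y : p, finrank ℝ (centralizerIn V (y : g))

/-- `R(p)` for the pair of algebras `(𝔥, 𝔩)` with complement `p`:
all `x ∈ p` such that both `dim 𝔥^x` and `dim 𝔩^x` are minimal among the elements of `p`. -/
def R (h l p : Submodule ℝ g) : Set g :=
  {x | x ∈ p ∧ finrank ℝ (centralizerIn h x) = minDim h p ∧
    finrank ℝ (centralizerIn l x) = minDim l p}

/-- `𝔨 = 𝔤^a`, as a linear subspace. -/
def k (a : g) : Submodule ℝ g := (centralizer a).toSubmodule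

/-- `𝔪 = 𝔨^⊥`, the orthogonal complement with respect to `⟨·,·⟩`. -/
def m (B : LinearMap.BilinForm ℝ g) (a : g) : Submodule ℝ g := B.orthogonal (k a)

/-- `r(𝔪) = q(𝔪) - p(𝔪)`; here `q(𝔪) ≥ p(𝔪)`, see `minDim_le`. -/
def r (B : LinearMap.BilinForm ℝ g) (a : g) : ℕ :=
  minDim ⊤ (m B a) - minDim (k a) (m B a)

/-- The subtraction in the definition of `r` does not truncate. -/
lemma minDim_le [FiniteDimensional ℝ g] (V p : Submodule ℝ g) : minDim V p ≤ minDim ⊤ p := by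
  refine le_ciInf fun y => (ciInf_le (OrderBot.bddBelow _) y).trans ?_
  exact Submodule.finrank_mono (inf_le_inf_right _ le_top)

/-- `𝔪(x) = {y ∈ 𝔪 : [x, y] ∈ 𝔪}`. -/
def mAt (B : LinearMap.BilinForm ℝ g) (a x : g) : Submodule ℝ g :=
  m B a ⊓ (m B a).comap (LieAlgebra.ad ℝ g x : g →ₗ[ℝ] g)

/-- The bilinear form `(y₁, y₂) ↦ -⟨a, [y₁, y₂]⟩` on `𝔤`. -/
def siForm (B : LinearMap.BilinForm ℝ g) (a : g) : LinearMap.BilinForm ℝ g :=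
  (LieAlgebra.ad ℝ g : g →ₗ[ℝ] g →ₗ[ℝ] g).compr₂ (-(B a))

lemma siForm_apply (B : LinearMap.BilinForm ℝ g) (a y₁ y₂ : g) :
    siForm B a y₁ y₂ = -B a ⁅y₁, y₂⁆ := rfl

/-- `B_x^{si}` as a complex bilinear form on the complexification of `𝔪(x)`: the complex bilinear
extension of `(y₁, y₂) ↦ -⟨a, [y₁, y₂]⟩` on `𝔪(x)`. -/
def Bsi (B : LinearMap.BilinForm ℝ g) (a x : g) :
    LinearMap.BilinForm ℂ (TensorProduct ℝ ℂ (mAt B a x)) :=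
  ((siForm B a).restrict (mAt B a x)).baseChange ℂ

/-- `Q_a(𝔪) = {x ∈ R(𝔪) : dim_ℂ ker B_x^{si} = r(𝔪)}`. -/
def Q (B : LinearMap.BilinForm ℝ g) (a : g) : Set g :=
  {x | x ∈ R ⊤ (k a) (m B a) ∧ finrank ℂ (LinearMap.ker (Bsi B a x)) = r B a}

/-- The fixed point space of `σ`, i.e. its eigenspace for the eigenvalue `1`. -/
def gTilde (σ : g ≃ₗ⁅ℝ⁆ g) : Submodule ℝ g :=
  LinearMap.ker (LinearMap.id - (σ : g →ₗ[ℝ] g))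

/-- The fixed points of `σ` in `𝔨`. -/
def kTilde (σ : g ≃ₗ⁅ℝ⁆ g) (a : g) : Submodule ℝ g := k a ⊓ gTilde σ

/-- The fixed points of `σ` in `𝔪`. -/
def mTilde (B : LinearMap.BilinForm ℝ g) (σ : g ≃ₗ⁅ℝ⁆ g) (a : g) : Submodule ℝ g :=
  m B a ⊓ gTilde σ

/-- `𝔨' = (1 - σ)𝔨`. -/
def kPrime (σ : g ≃ₗ⁅ℝ⁆ g) (a : g) : Submodule ℝ g :=
  (k a).map (LinearMap.id - (σ : g →ₗ[ℝ] g))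

/-- `α` is a regular element of `𝔨 = 𝔤^a`: `α ∈ 𝔨` and `dim 𝔨^α = rank 𝔨`. -/
def IsRegularInK [FiniteDimensional ℝ g] (a α : g) : Prop :=
  α ∈ k a ∧ finrank ℝ (centralizerIn (k a) α) = LieAlgebra.rank ℝ (centralizer a)

end

end Suborbit

/-!
# Points of `Q_a(𝔪)` fixed by an involution

Let `A` be the inverse of `ad a` on `𝔪` and let `c(x) ∈ 𝔨` be half the `𝔨`-component of `[x, A x]`
(`moment`), a quadratic moment map `𝔪 → 𝔨`. Invariance of the inner product shows that the
`𝔨`-component of `[x, A [x, z]]` is `[c(x), z]` for `z ∈ 𝔨` (`inner_lie_moment`). Hence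
`z ↦ A [x, z]` identifies `𝔨^{c(x)} / 𝔨^x` with the real kernel of `B_x^{si}`
(`map_centralizerIn_moment`), and the complex kernel has the same dimension. So for `x ∈ R(𝔪)` the
condition `x ∈ Q_a(𝔪)` reads `dim 𝔨^{c(x)} = q(𝔪)`.

Minimality of `dim 𝔤^{x₀}` on `𝔪` gives `[𝔤^{x₀}, 𝔤^{x₀}] ⊆ 𝔨^{x₀}`. As `𝔨^{x₀}` is the centre,
`𝔤^{x₀}` is abelian (`lie_eq_zero_of_mem_R`). By Hunt's argument some automorphism moves `x₀` into
`𝔨` (`exists_lieEquiv_lie_eq_zero`), and this yields `rank 𝔨 = dim 𝔤^{x₀} = q(𝔪)`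
(`rank_centralizer_eq`). Therefore `x ∈ Q_a(𝔪)` if and only if `c(x)` is regular in `𝔨`
(`mem_Q_iff`).

Since `σ a = -a`, the map `c` sends `𝔪̃` into `𝔨'`, which proves one direction. For the other one,
the derivative of `c` at `x₀` maps `𝔪̃` onto the orthogonal complement of the centre in `𝔨'`, because
a vector of `𝔨'` orthogonal to its image commutes with `x₀` (`exists_moment_add_moment`). So near
`x₀` the values of `c` fill a neighbourhood of `c(x₀)` in this complement. It meets the regular
elements, which are Zariski open and exist in `𝔨'` by assumption, and points of `𝔪̃` near `x₀` stay in
`R(𝔪)` by semicontinuity.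
-/

namespace Suborbit

open Module Filter Topology

/-! ### Kernels of families of linear maps -/

/-- The complex kernel of the complexification of a real bilinear form has the dimension of the
real kernel: the kernel is spanned over `ℂ` by the real one. -/
lemma finrank_ker_baseChange {M : Type*} [AddCommGroup M] [Module ℝ M]
    (b : LinearMap.BilinForm ℝ M) :
    finrank ℂ (LinearMap.ker (b.baseChange ℂ)) = finrank ℝ (LinearMap.ker b) := by
  set N := LinearMap.ker b
  have hinj : Function.Injective (N.subtype.baseChange ℂ) :=
    Module.Flat.lTensor_preserves_injective_linearMap (M := ℂ) N.subtype N.injective_subtype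
  -- Decompose into real and imaginary parts.
  have hform (z : TensorProduct ℝ ℂ M) : ∃ u v : M, z = 1 ⊗ₜ[ℝ] u + Complex.I ⊗ₜ[ℝ] v := by
    induction z with
    | zero => exact ⟨0, 0, by simp⟩
    | tmul c x =>
      refine ⟨c.re • x, c.im • x, ?_⟩
      rw [← TensorProduct.smul_tmul, ← TensorProduct.smul_tmul, ← TensorProduct.add_tmul]
      congr 1
      simp
    | add z w hz hw =>
      obtain ⟨u, v, rfl⟩ := hz
      obtain ⟨u', v', rfl⟩ := hw
      exact ⟨u + u', v + v', by simp only [TensorProduct.tmul_add]; abel⟩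
  have hker : LinearMap.ker (b.baseChange ℂ) = LinearMap.range (N.subtype.baseChange ℂ) := by
    apply le_antisymm
    · intro z hz
      obtain ⟨u, v, rfl⟩ := hform z
      have key (w : M) : b u w = 0 ∧ b v w = 0 := by
        have h := LinearMap.congr_fun (LinearMap.mem_ker.1 hz) (1 ⊗ₜ[ℝ] w)
        simp only [map_add, LinearMap.add_apply, LinearMap.BilinForm.baseChange_tmul,
          LinearMap.zero_apply] at h
        simpa [Complex.ext_iff] using h
      have hu : u ∈ N := LinearMap.mem_ker.2 (LinearMap.ext fun w => (key w).1)
      have hv : v ∈ N := LinearMap.mem_ker.2 (LinearMap.ext fun w => (key w).2)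
      exact ⟨1 ⊗ₜ[ℝ] (⟨u, hu⟩ : N) + Complex.I ⊗ₜ[ℝ] (⟨v, hv⟩ : N), by simp⟩
    · rintro _ ⟨z, rfl⟩
      induction z with
      | zero => simp
      | tmul c x =>
        refine LinearMap.mem_ker.2 (LinearMap.ext fun w => ?_)
        induction w with
        | zero => simp
        | tmul d y =>
          have hx : b (x : M) = 0 := x.2
          simp [hx]
        | add w w' hw hw' => simp_all
      | add z w hz hw => rw [map_add]; exact add_mem hz hw
  rw [hker, LinearMap.finrank_range_of_inj hinj, Module.finrank_baseChange]

section Semicontinuity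

variable {W W' : Type*} [AddCommGroup W] [Module ℝ W] [FiniteDimensional ℝ W]
  [AddCommGroup W'] [Module ℝ W'] [FiniteDimensional ℝ W']

/-- Kernel dimensions of a linear family of linear maps are upper semicontinuous. -/
lemma eventually_finrank_ker_le {V : Type*} [NormedAddCommGroup V] [NormedSpace ℝ V]
    [FiniteDimensional ℝ V] (Λ : V →ₗ[ℝ] W →ₗ[ℝ] W') (x₀ : V) :
    ∀ᶠ x in 𝓝 x₀, finrank ℝ (LinearMap.ker (Λ x)) ≤ finrank ℝ (LinearMap.ker (Λ x₀)) := by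
  let e := (finBasis ℝ W).equivFun
  let e' := (finBasis ℝ W').equivFun
  let : NormedAddCommGroup W := NormedAddCommGroup.induced W _ e.toLinearMap e.injective
  let : NormedSpace ℝ W := NormedSpace.induced ℝ W _ e.toLinearMap
  let : NormedAddCommGroup W' := NormedAddCommGroup.induced W' _ e'.toLinearMap e'.injective
  let : NormedSpace ℝ W' := NormedSpace.induced ℝ W' _ e'.toLinearMap
  let Γ : V →ₗ[ℝ] W →L[ℝ] W' := LinearMap.toContinuousLinearMap.toLinearMap ∘ₗ Λ
  have hΓ : Continuous Γ := Γ.continuous_of_finiteDimensional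
  have hopen := isOpen_setOfPred_nat_le_rank (𝕜 := ℝ) (E := W) (F := W')
    (finrank ℝ (LinearMap.range (Λ x₀)))
  have hmem : {f : W →L[ℝ] W' | ((finrank ℝ (LinearMap.range (Λ x₀)) : ℕ) : Cardinal) ≤
      (f : W →ₗ[ℝ] W').rank} ∈ 𝓝 (Γ x₀) := hopen.mem_nhds (by
    rw [Set.mem_ofPred_eq]
    exact (finrank_eq_rank ℝ (LinearMap.range (Λ x₀))).le)
  filter_upwards [hΓ.continuousAt hmem] with x hx
  replace hx : ((finrank ℝ (LinearMap.range (Λ x₀)) : ℕ) : Cardinal) ≤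
    LinearMap.rank (Λ x) := hx
  rw [LinearMap.rank, ← finrank_eq_rank, Nat.cast_le] at hx
  have h1 := (Λ x).finrank_range_add_finrank_ker
  have h2 := (Λ x₀).finrank_range_add_finrank_ker
  omega

/-- First-order perturbation: if the kernel of `L` has minimal dimension in the pencil `L + t M`,
then `M` maps the kernel of `L` into the range of `L`. -/
lemma apply_mem_range_of_finrank_ker_le (L M : W →ₗ[ℝ] W')
    (h : ∀ t : ℝ, finrank ℝ (LinearMap.ker L) ≤ finrank ℝ (LinearMap.ker (L + t • M)))
    {z : W} (hz : L z = 0) : M z ∈ LinearMap.range L := by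
  by_contra hMz
  -- The family `(w, s) ↦ (L + t M) w + s M z` has kernel of dimension `dim ker L` at `t = 0`.
  -- For `t ≠ 0` its kernel contains `ker (L + t M)` and the further vector `(z, -t)`.
  let Λ : (ℝ × ℝ) →ₗ[ℝ] (W × ℝ) →ₗ[ℝ] W' :=
    LinearMap.mk₂ ℝ (fun p w => p.1 • (L w.1 + w.2 • M z) + p.2 • M w.1)
      (by intros; simp; module) (by intros; simp; module) (by intros; simp; module)
      (by intros; simp; module)
  have hΛ (p : ℝ × ℝ) (w : W × ℝ) : Λ p w = p.1 • (L w.1 + w.2 • M z) + p.2 • M w.1 := rfl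
  have h0 : finrank ℝ (LinearMap.ker (Λ (1, 0))) ≤ finrank ℝ (LinearMap.ker L) := by
    have hsub : LinearMap.ker (Λ (1, 0)) ≤ (LinearMap.ker L).map (LinearMap.inl ℝ W ℝ) := by
      rintro ⟨w, s⟩ hw
      have hw' : L w + s • M z = 0 := by simpa [hΛ] using hw
      by_cases hs : s = 0
      · subst hs
        exact ⟨w, by simpa using hw', by simp⟩
      · refine (hMz ⟨-(s⁻¹ • w), ?_⟩).elim
        rw [map_neg, map_smul, eq_neg_of_add_eq_zero_left hw', smul_neg, neg_neg, smul_smul,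
          inv_mul_cancel₀ hs, one_smul]
    exact (Submodule.finrank_mono hsub).trans (Submodule.finrank_map_le _ _)
  have h1 (t : ℝ) (ht : t ≠ 0) :
      finrank ℝ (LinearMap.ker L) < finrank ℝ (LinearMap.ker (Λ (1, t))) := by
    have hlt : (LinearMap.ker (L + t • M)).map (LinearMap.inl ℝ W ℝ) <
        LinearMap.ker (Λ (1, t)) := by
      refine SetLike.lt_iff_le_and_exists.2 ⟨?_, (z, -t), ?_, ?_⟩
      · rintro _ ⟨w, hw, rfl⟩
        have hw' : L w + t • M w = 0 := hw
        simpa [hΛ] using hw'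
      · simp [hΛ, hz]
      · rintro ⟨w, -, hw⟩
        exact ht (by simpa using (congrArg Prod.snd hw).symm)
    have := Submodule.finrank_lt_finrank_of_lt hlt
    rw [← (Submodule.equivMapOfInjective _ LinearMap.inl_injective
      (LinearMap.ker (L + t • M))).finrank_eq] at this
    exact (h t).trans_lt this
  have hcont : Tendsto (fun t : ℝ => ((1 : ℝ), t)) (𝓝[≠] 0) (𝓝 (1, 0)) :=
    ((Continuous.prodMk_right (1 : ℝ)).tendsto 0).mono_left nhdsWithin_le_nhds
  obtain ⟨t, ht, ht0⟩ :=
    ((hcont.eventually (eventually_finrank_ker_le Λ (1, 0))).and self_mem_nhdsWithin).exists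
  exact absurd (h1 t ht0) (not_lt.2 (ht.trans h0))

/-- If the derivative of a quadratic map `x ↦ β x x` at `x₀` is onto, then every nearby value is
attained at points `x` so close to `x₀` that the kernels of two given linear families of linear
maps are no larger at `x` than at `x₀`. -/
lemma exists_quadratic_eq {V F U U' : Type*}
    [AddCommGroup V] [Module ℝ V] [FiniteDimensional ℝ V]
    [AddCommGroup F] [Module ℝ F] [FiniteDimensional ℝ F]
    [AddCommGroup U] [Module ℝ U] [FiniteDimensional ℝ U]
    [AddCommGroup U'] [Module ℝ U'] [FiniteDimensional ℝ U']
    (β : V →ₗ[ℝ] V →ₗ[ℝ] F) (x₀ : V) (hsurj : ∀ f, ∃ w, β x₀ w + β w x₀ = f)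
    (Λ : V →ₗ[ℝ] W →ₗ[ℝ] W') (Λ' : V →ₗ[ℝ] U →ₗ[ℝ] U') (f : F) :
    ∀ᶠ t : ℝ in 𝓝 0, ∃ x, β x x = β x₀ x₀ + t • f ∧
      finrank ℝ (LinearMap.ker (Λ x)) ≤ finrank ℝ (LinearMap.ker (Λ x₀)) ∧
      finrank ℝ (LinearMap.ker (Λ' x)) ≤ finrank ℝ (LinearMap.ker (Λ' x₀)) := by
  let e := (finBasis ℝ V).equivFun
  let e' := (finBasis ℝ F).equivFun
  let : NormedAddCommGroup V := NormedAddCommGroup.induced V _ e.toLinearMap e.injective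
  let : NormedSpace ℝ V := NormedSpace.induced ℝ V _ e.toLinearMap
  let : NormedAddCommGroup F := NormedAddCommGroup.induced F _ e'.toLinearMap e'.injective
  let : NormedSpace ℝ F := NormedSpace.induced ℝ F _ e'.toLinearMap
  have : CompleteSpace V := FiniteDimensional.complete ℝ V
  have : CompleteSpace F := FiniteDimensional.complete ℝ F
  let βc : V →L[ℝ] V →L[ℝ] F :=
    LinearMap.toContinuousLinearMap (LinearMap.toContinuousLinearMap.toLinearMap ∘ₗ β)
  have hd : HasStrictFDerivAt (fun x => βc x x) _ x₀ :=
    (βc.hasStrictFDerivAt (x := x₀)).clm_apply (hasStrictFDerivAt_id x₀)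
  have hmap := hd.map_nhds_eq_of_surj (by
    rw [LinearMap.range_eq_top]
    intro f
    obtain ⟨w, hw⟩ := hsurj f
    refine ⟨w, ?_⟩
    simpa [βc] using hw)
  have hev := (eventually_finrank_ker_le Λ x₀).and (eventually_finrank_ker_le Λ' x₀)
  have himg : (fun x => βc x x) '' {x | finrank ℝ (LinearMap.ker (Λ x)) ≤
      finrank ℝ (LinearMap.ker (Λ x₀)) ∧
      finrank ℝ (LinearMap.ker (Λ' x)) ≤ finrank ℝ (LinearMap.ker (Λ' x₀))} ∈
      𝓝 (βc x₀ x₀) := by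
    rw [← hmap]
    exact image_mem_map hev
  have hline : Tendsto (fun t : ℝ => βc x₀ x₀ + t • f) (𝓝 0) (𝓝 (βc x₀ x₀)) := by
    have : Continuous fun t : ℝ => βc x₀ x₀ + t • f := by fun_prop
    simpa using this.tendsto 0
  filter_upwards [hline himg] with t ht
  obtain ⟨x, hx, hxt⟩ := ht
  exact ⟨x, hxt, hx⟩

end Semicontinuity

/-! ### Exponentials of derivations and Hunt's argument -/

section Exp

open NormedSpace
open scoped InnerProductSpace

variable {E : Type*} [NormedAddCommGroup E] [InnerProductSpace ℝ E] [FiniteDimensional ℝ E]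

lemma hasDerivAt_exp_smul_apply (D : E →L[ℝ] E) (u : E) (t : ℝ) :
    HasDerivAt (fun s : ℝ => exp (s • D) u) (D (exp (t • D) u)) t := by
  simpa using (hasDerivAt_exp_smul_const' D t).clm_apply (hasDerivAt_const t u)

/-- The exponential of a derivation is an automorphism. -/
lemma exp_smul_map_bracket (br : E →L[ℝ] E →L[ℝ] E) (D : E →L[ℝ] E)
    (hD : ∀ u v, D (br u v) = br (D u) v + br u (D v)) (t : ℝ) (u v : E) :
    exp (t • D) (br u v) = br (exp (t • D) u) (exp (t • D) v) := by
  have hder (s : ℝ) : HasDerivAt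
      (fun s : ℝ => exp (s • -D) (br (exp (s • D) u) (exp (s • D) v))) 0 s := by
    have h1 := hasDerivAt_exp_smul_const (-D) s
    have h2 := ((br.hasFDerivAt.comp_hasDerivAt s
      (hasDerivAt_exp_smul_apply D u s)).clm_apply (hasDerivAt_exp_smul_apply D v s))
    convert! h1.clm_apply h2 using 1
    rw [Function.comp_apply, mul_apply_eq_comp, neg_apply, hD, map_neg, neg_add_cancel]
  have hconst := is_const_of_deriv_eq_zero (fun s => (hder s).differentiableAt)
    (fun s => (hder s).deriv) t 0
  have hinv : exp (t • D) * exp (t • -D) = 1 := by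
    let : NormedAlgebra ℚ (E →L[ℝ] E) := NormedAlgebra.restrictScalars ℚ ℝ _
    rw [← exp_add_of_commute (by simp [Commute.neg_right_iff]), smul_neg, add_neg_cancel, exp_zero]
  simp only [zero_smul, exp_zero, one_apply_eq_self] at hconst
  rw [← hconst, ← mul_apply_eq_comp, hinv, one_apply_eq_self]

/-- The exponential of a skew-symmetric operator is orthogonal. -/
lemma inner_exp_smul (D : E →L[ℝ] E) (hD : ∀ u v, ⟪D u, v⟫_ℝ = -⟪u, D v⟫_ℝ) (t : ℝ) (u v : E) :
    ⟪exp (t • D) u, exp (t • D) v⟫_ℝ = ⟪u, v⟫_ℝ := by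
  have hder (s : ℝ) : HasDerivAt (fun s : ℝ => ⟪exp (s • D) u, exp (s • D) v⟫_ℝ) 0 s := by
    convert! (hasDerivAt_exp_smul_apply D u s).inner ℝ (hasDerivAt_exp_smul_apply D v s) using 1
    rw [hD, add_neg_cancel]
  simpa using is_const_of_deriv_eq_zero (fun s => (hder s).differentiableAt)
    (fun s => (hder s).deriv) t 0

/-- Hunt's argument: among the isometric automorphisms `φ`, which form a compact set, choose one
maximising `⟪φ x, y⟫`; the first-order condition along `exp (t ad z) ∘ φ` says that `φ x` and `y`
commute. -/
lemma exists_isometry_bracket_eq_zero (br : E →L[ℝ] E →L[ℝ] E)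
    (hskew : ∀ u v, br u v = -br v u)
    (hjac : ∀ z u v, br z (br u v) = br (br z u) v + br u (br z v))
    (hinv : ∀ z u v, ⟪br z u, v⟫_ℝ = -⟪u, br z v⟫_ℝ) (x y : E) :
    ∃ φ : E →L[ℝ] E, (∀ u v, φ (br u v) = br (φ u) (φ v)) ∧
      (∀ u v, ⟪φ u, φ v⟫_ℝ = ⟪u, v⟫_ℝ) ∧ br (φ x) y = 0 := by
  have : ProperSpace (E →L[ℝ] E) := FiniteDimensional.proper ℝ _
  let S : Set (E →L[ℝ] E) := {φ | (∀ u v, φ (br u v) = br (φ u) (φ v)) ∧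
      (∀ u v, ⟪φ u, φ v⟫_ℝ = ⟪u, v⟫_ℝ)}
  have hclosed : IsClosed S := by
    simp only [S, Set.ofPred_and, Set.ofPred_forall]
    refine IsClosed.inter (isClosed_iInter fun u => isClosed_iInter fun v => ?_)
      (isClosed_iInter fun u => isClosed_iInter fun v => ?_)
    · exact isClosed_eq (by fun_prop) (by fun_prop)
    · exact isClosed_eq (by fun_prop) (by fun_prop)
  have hcompact : IsCompact S := by
    refine (isCompact_closedBall (0 : E →L[ℝ] E) 1).of_isClosed_subset hclosed fun φ hφ => ?_
    rw [mem_closedBall_zero_iff]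
    refine φ.opNorm_le_bound zero_le_one fun u => ?_
    rw [one_mul, norm_eq_sqrt_real_inner, norm_eq_sqrt_real_inner u, hφ.2]
  obtain ⟨φ, hφ, hmax⟩ := hcompact.exists_isMaxOn ⟨1, fun _ _ => rfl, fun _ _ => rfl⟩
    (f := fun φ : E →L[ℝ] E => ⟪φ x, y⟫_ℝ) (by fun_prop)
  refine ⟨φ, hφ.1, hφ.2, ?_⟩
  have key (z : E) : ⟪br z (φ x), y⟫_ℝ = 0 := by
    have hd : HasDerivAt (fun t : ℝ => ⟪exp (t • br z) (φ x), y⟫_ℝ) ⟪br z (φ x), y⟫_ℝ 0 := by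
      simpa using (hasDerivAt_exp_smul_apply (br z) (φ x) 0).inner ℝ (hasDerivAt_const 0 y)
    refine IsLocalMax.hasDerivAt_eq_zero (Eventually.of_forall fun t => ?_) hd
    have hmem : exp (t • br z) * φ ∈ S := by
      refine ⟨fun u v => ?_, fun u v => ?_⟩
      · simp only [mul_apply_eq_comp, hφ.1]
        exact exp_smul_map_bracket br (br z) (hjac z) t _ _
      · simp only [mul_apply_eq_comp]
        rw [inner_exp_smul (br z) (hinv z), hφ.2]
    simpa using hmax hmem
  refine ext_inner_left ℝ fun z => ?_
  have h := key z
  rw [hskew, inner_neg_left, hinv, neg_neg] at h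
  rw [inner_zero_right, real_inner_comm, ← h, real_inner_comm]

end Exp

/-! ### Centralizers, rank and regular elements of a compact Lie algebra -/

section Compact

variable {L : Type*} [LieRing L] [LieAlgebra ℝ L] {B : LinearMap.BilinForm ℝ L}

/-- `B` is an invariant inner product on the Lie algebra `L`; thus `L` is a compact Lie algebra. -/
structure IsInvariantInner (B : LinearMap.BilinForm ℝ L) : Prop where
  symm : ∀ x y : L, B x y = B y x
  pos : ∀ x : L, x ≠ 0 → 0 < B x x
  inv : ∀ x y z : L, B ⁅x, y⁆ z = -B y ⁅x, z⁆

/-- Any element of a compact Lie algebra can be moved by an automorphism so as to commute with a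
given one. -/
lemma exists_lieEquiv_lie_eq_zero [FiniteDimensional ℝ L] (hB : IsInvariantInner B) (x y : L) :
    ∃ φ : L ≃ₗ⁅ℝ⁆ L, ⁅φ x, y⁆ = 0 := by
  let core : InnerProductSpace.Core ℝ L :=
    { inner := fun u v => B u v
      conj_inner_symm := fun u v => hB.symm v u
      re_inner_nonneg := fun u => by
        by_cases hu : u = 0
        · simp [hu]
        · exact (hB.pos u hu).le
      add_left := fun u v w => by simp
      smul_left := fun u v c => by simp
      definite := fun u hu => by
        by_contra h
        exact (hB.pos u h).ne' hu }
  let : NormedAddCommGroup L := core.toNormedAddCommGroup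
  let : InnerProductSpace ℝ L := InnerProductSpace.ofCore core.toCore
  let br : L →L[ℝ] L →L[ℝ] L := LinearMap.toContinuousLinearMap
    (LinearMap.toContinuousLinearMap.toLinearMap ∘ₗ (LieAlgebra.ad ℝ L : L →ₗ[ℝ] L →ₗ[ℝ] L))
  have hbr (u v : L) : br u v = ⁅u, v⁆ := rfl
  obtain ⟨φ, h1, h2, h3⟩ := exists_isometry_bracket_eq_zero br
    (fun u v => by rw [hbr, hbr, lie_skew])
    (fun z u v => by simp only [hbr]; rw [leibniz_lie])
    (fun z u v => hB.inv z u v) x y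
  have hinj : Function.Injective φ := by
    rw [injective_iff_map_eq_zero]
    intro u hu
    have h : B (φ u) (φ u) = B u u := h2 u u
    by_contra hne
    rw [hu] at h
    exact (hB.pos u hne).ne (by simpa using h)
  let f : L →ₗ⁅ℝ⁆ L := { (φ : L →ₗ[ℝ] L) with map_lie' := fun {u v} => h1 u v }
  refine ⟨LieEquiv.ofBijective f ⟨hinj, ?_⟩, h3⟩
  exact LinearMap.surjective_of_injective (f := (φ : L →ₗ[ℝ] L)) hinj

/-- `ad x` is semisimple, so its generalised null space is the centralizer of `x`. -/
lemma finrank_engel_eq (hB : IsInvariantInner B) (x : L) :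
    finrank ℝ (LieSubalgebra.engel ℝ x) =
      finrank ℝ (LinearMap.ker (LieAlgebra.ad ℝ L x : L →ₗ[ℝ] L)) := by
  have hstep (y : L) (hy : ⁅x, ⁅x, y⁆⁆ = 0) : ⁅x, y⁆ = 0 := by
    by_contra h
    have := hB.pos _ h
    rw [hB.inv, hy] at this
    simp at this
  have hpow (n : ℕ) (y : L) (hy : ((LieAlgebra.ad ℝ L x) ^ (n + 1)) y = 0) : ⁅x, y⁆ = 0 := by
    induction n generalizing y with
    | zero => simpa using hy
    | succ n ih => exact hstep y (ih ⁅x, y⁆ (by rw [pow_succ] at hy; simpa using hy))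
  have h : (LieSubalgebra.engel ℝ x).toSubmodule =
      LinearMap.ker (LieAlgebra.ad ℝ L x : L →ₗ[ℝ] L) := by
    ext y
    rw [LieSubalgebra.mem_toSubmodule, LieSubalgebra.mem_engel_iff, LinearMap.mem_ker]
    constructor
    · rintro ⟨n, hn⟩
      refine hpow n y ?_
      rw [pow_succ', Module.End.mul_apply, hn, map_zero]
    · intro hy
      exact ⟨1, by simpa using hy⟩
  rw [← h]
  rfl

/-- In a compact Lie algebra an abelian centralizer `𝔩^h` has dimension equal to the rank: every
regular element is conjugate to an element of `𝔩^h`, whose centralizer contains `𝔩^h`. -/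
lemma rank_eq_finrank_centralizer [FiniteDimensional ℝ L] (hB : IsInvariantInner B) (h : L)
    (hab : ∀ u v : L, ⁅h, u⁆ = 0 → ⁅h, v⁆ = 0 → ⁅u, v⁆ = 0) :
    LieAlgebra.rank ℝ L = finrank ℝ (LinearMap.ker (LieAlgebra.ad ℝ L h : L →ₗ[ℝ] L)) := by
  apply le_antisymm
  · rw [← finrank_engel_eq hB]
    exact LieAlgebra.rank_le_finrank_engel ℝ h
  · obtain ⟨x, hx⟩ := LieAlgebra.exists_isRegular ℝ L
    rw [LieAlgebra.isRegular_iff_finrank_engel_eq_rank, finrank_engel_eq hB] at hx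
    rw [← hx]
    obtain ⟨φ, hφ⟩ := exists_lieEquiv_lie_eq_zero hB x h
    have hle : LinearMap.ker (LieAlgebra.ad ℝ L h : L →ₗ[ℝ] L) ≤
        (LinearMap.ker (LieAlgebra.ad ℝ L x : L →ₗ[ℝ] L)).map (φ : L →ₗ[ℝ] L) := by
      intro u hu
      refine ⟨φ.symm u, ?_, φ.apply_symm_apply u⟩
      have hux : ⁅φ x, u⁆ = 0 := hab _ _ (by rw [← lie_skew, hφ, neg_zero]) hu
      change ⁅x, φ.symm u⁆ = 0
      apply φ.injective
      change φ ⁅x, φ.symm u⁆ = φ 0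
      rw [LieEquiv.map_lie, φ.apply_symm_apply, hux, ← LieEquiv.coe_toLinearEquiv, _root_.map_zero]
    exact (Submodule.finrank_mono hle).trans (Submodule.finrank_map_le _ _)

/-- If `α` is regular, then `c + t α` is regular for all but finitely many `t ≠ 0`, in particular
for all small ones: regularity is Zariski open and invariant under scaling, so that one may consider
`α + t⁻¹ c` instead. -/
lemma eventually_isRegular_add_smul [FiniteDimensional ℝ L] (hB : IsInvariantInner B) {α : L}
    (hα : LieAlgebra.IsRegular ℝ α) (c : L) :
    ∀ᶠ t : ℝ in 𝓝[≠] 0, LieAlgebra.IsRegular ℝ (c + t • α) := by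
  obtain ⟨P, hreg⟩ : ∃ P : MvPolynomial (Fin (finrank ℝ L)) ℝ, ∀ x : L,
      LieAlgebra.IsRegular ℝ x ↔ MvPolynomial.eval ((finBasis ℝ L).repr x) P ≠ 0 :=
    ⟨_, fun x => LieAlgebra.isRegular_iff_coeff_polyCharpoly_rank_ne_zero ℝ (finBasis ℝ L) x⟩
  -- The restriction of `P` to the line `s ↦ α + s • c`, where `s = t⁻¹`.
  let p : Polynomial ℝ := MvPolynomial.aeval (fun i => Polynomial.C ((finBasis ℝ L).repr α i) +
    Polynomial.X * Polynomial.C ((finBasis ℝ L).repr c i)) P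
  have hp (s : ℝ) : p.eval s = MvPolynomial.eval ((finBasis ℝ L).repr (α + s • c)) P := by
    rw [← Polynomial.coe_aeval_eq_eval, MvPolynomial.comp_aeval_apply, MvPolynomial.aeval_eq_eval]
    congr 2
    ext i
    simp only [map_add, map_mul, Polynomial.aeval_C, Polynomial.aeval_X, map_smul,
      Finsupp.add_apply, Finsupp.smul_apply, smul_eq_mul, Algebra.algebraMap_self, RingHom.id_apply]
  have hp0 : p ≠ 0 := by
    intro h
    have := hp 0
    rw [h, zero_smul, add_zero, Polynomial.eval_zero] at this
    exact (hreg α).1 hα this.symm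
  have hfin : Set.Finite {s : ℝ | p.eval s = 0} := Polynomial.finite_setOfPred_isRoot hp0
  have hfin' : Set.Finite {t : ℝ | p.eval t⁻¹ = 0} :=
    hfin.preimage inv_injective.injOn
  have hev : ∀ᶠ t : ℝ in 𝓝[≠] 0, p.eval t⁻¹ ≠ 0 := by
    have h0 := (hfin'.sdiff (t := {0})).isClosed.isOpen_compl.mem_nhds (x := (0 : ℝ)) (by simp)
    filter_upwards [mem_nhdsWithin_of_mem_nhds h0, self_mem_nhdsWithin] with t ht ht0 h
    exact ht ⟨h, ht0⟩
  filter_upwards [hev, self_mem_nhdsWithin] with t ht ht0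
  have ht0' : t ≠ 0 := ht0
  rw [hp, ← hreg, LieAlgebra.isRegular_iff_finrank_engel_eq_rank,
    finrank_engel_eq hB] at ht
  have hscale : α + t⁻¹ • c = t⁻¹ • (c + t • α) := by
    rw [smul_add, smul_smul, inv_mul_cancel₀ ht0', one_smul, add_comm]
  rw [hscale, map_smul, LinearMap.ker_smul _ _ (inv_ne_zero ht0')] at ht
  rwa [LieAlgebra.isRegular_iff_finrank_engel_eq_rank, finrank_engel_eq hB]

end Compact

variable {g : Type*} [LieRing g] [LieAlgebra ℝ g] {B : LinearMap.BilinForm ℝ g} {a x : g}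

/-! ### Orthogonality with respect to the invariant inner product -/

namespace IsInvariantInner

lemma eq_zero (hB : IsInvariantInner B) {u : g} (h : B u u = 0) : u = 0 := by
  by_contra hu
  exact (hB.pos u hu).ne' h

lemma inv_right (hB : IsInvariantInner B) (u v w : g) : B u ⁅v, w⁆ = B ⁅u, v⁆ w := by
  rw [← lie_skew u v, map_neg, LinearMap.neg_apply, hB.inv, neg_neg]

end IsInvariantInner

/-- `P` is the orthogonal projection onto `K` with respect to `B`. -/
def IsOrthProj (B : LinearMap.BilinForm ℝ g) (K : Submodule ℝ g) (P : g →ₗ[ℝ] g) : Prop :=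
  ∀ u, P u ∈ K ∧ ∀ z ∈ K, B z (P u) = B z u

lemma exists_isOrthProj [FiniteDimensional ℝ g] (hB : IsInvariantInner B) (K : Submodule ℝ g) :
    ∃ P, IsOrthProj B K P := by
  have hinj : Function.Injective (B.restrict K) := by
    rw [injective_iff_map_eq_zero]
    intro u hu
    exact Subtype.ext (hB.eq_zero (LinearMap.congr_fun hu u))
  let e : K ≃ₗ[ℝ] Dual ℝ K :=
    LinearEquiv.ofInjectiveOfFinrankEq (B.restrict K) hinj Subspace.dual_finrank_eq.symm
  refine ⟨K.subtype ∘ₗ e.symm.toLinearMap ∘ₗ K.subtype.dualMap ∘ₗ B, fun u => ⟨?_, fun z hz => ?_⟩⟩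
  · exact (e.symm (K.subtype.dualMap (B u))).2
  · have h : e (e.symm (K.subtype.dualMap (B u))) ⟨z, hz⟩ = B u z := by
      rw [e.apply_symm_apply]; rfl
    rw [hB.symm z u, hB.symm]
    exact h

lemma IsOrthProj.eq_of_mem (hB : IsInvariantInner B) {K : Submodule ℝ g} {P : g →ₗ[ℝ] g}
    (hP : IsOrthProj B K P) {u v : g} (hv : v ∈ K) (h : ∀ z ∈ K, B z v = B z u) : P u = v := by
  rw [← sub_eq_zero]
  apply hB.eq_zero
  have hmem := sub_mem (hP u).1 hv
  rw [map_sub, (hP u).2 _ hmem, h _ hmem, sub_self]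

/-- Double orthogonality: `(S^⊥)^⊥ = S`. -/
lemma mem_of_forall_orthogonal [FiniteDimensional ℝ g] (hB : IsInvariantInner B)
    {S : Submodule ℝ g} {u : g} (h : ∀ t, (∀ s ∈ S, B s t = 0) → B u t = 0) : u ∈ S := by
  obtain ⟨P, hP⟩ := exists_isOrthProj hB S
  have hort (s : g) (hs : s ∈ S) : B s (u - P u) = 0 := by rw [map_sub, (hP u).2 s hs, sub_self]
  have h0 : u - P u = 0 := by
    apply hB.eq_zero
    rw [map_sub B u, LinearMap.sub_apply, h _ hort, hort _ (hP u).1, sub_self]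
  rw [sub_eq_zero.1 h0]
  exact (hP u).1

lemma mem_k {z : g} : z ∈ k a ↔ ⁅a, z⁆ = 0 := Iff.rfl

lemma mem_centralizerIn {V : Submodule ℝ g} {z : g} :
    z ∈ centralizerIn V x ↔ z ∈ V ∧ ⁅x, z⁆ = 0 := Iff.rfl

lemma mem_m {y : g} : y ∈ m B a ↔ ∀ z ∈ k a, B z y = 0 :=
  LinearMap.BilinForm.mem_orthogonal_iff

lemma mem_mAt {y : g} : y ∈ mAt B a x ↔ y ∈ m B a ∧ ⁅x, y⁆ ∈ m B a := Iff.rfl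

lemma centralizerIn_top (x : g) :
    centralizerIn ⊤ x = LinearMap.ker (LieAlgebra.ad ℝ g x : g →ₗ[ℝ] g) := by
  ext z
  simp [mem_centralizerIn]

lemma lie_mem_k {z w : g} (hz : z ∈ k a) (hw : w ∈ k a) : ⁅z, w⁆ ∈ k a :=
  (centralizer a).lie_mem hz hw

lemma lie_mem_m_of_mem_k (hB : IsInvariantInner B) {z y : g} (hz : z ∈ k a) (hy : y ∈ m B a) :
    ⁅z, y⁆ ∈ m B a :=
  mem_m.2 fun w hw => by rw [hB.inv_right, mem_m.1 hy _ (lie_mem_k hw hz)]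

lemma lie_mem_m_of_mem_m (hB : IsInvariantInner B) {z y : g} (hz : z ∈ k a) (hy : y ∈ m B a) :
    ⁅y, z⁆ ∈ m B a := by
  rw [← lie_skew]
  exact neg_mem (lie_mem_m_of_mem_k hB hz hy)

lemma lie_self_mem_m (hB : IsInvariantInner B) (y : g) : ⁅a, y⁆ ∈ m B a :=
  mem_m.2 fun w hw => by
    rw [hB.inv_right, ← lie_skew, mem_k.1 hw, neg_zero, map_zero, LinearMap.zero_apply]

lemma eq_zero_of_mem_k_of_mem_m (hB : IsInvariantInner B) {y : g} (hk : y ∈ k a)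
    (hm : y ∈ m B a) : y = 0 :=
  hB.eq_zero (mem_m.1 hm y hk)

lemma eq_of_lie_eq (hB : IsInvariantInner B) {y y' : g} (hy : y ∈ m B a) (hy' : y' ∈ m B a)
    (h : ⁅a, y⁆ = ⁅a, y'⁆) : y = y' := by
  rw [← sub_eq_zero]
  exact eq_zero_of_mem_k_of_mem_m hB (by rw [mem_k, lie_sub, h, sub_self]) (sub_mem hy hy')

/-! ### The kernel of the form as a centralizer in `𝔨` -/

/-- `A` restricts on `𝔪` to the inverse of `ad a`. -/
def IsAdInverse (B : LinearMap.BilinForm ℝ g) (a : g) (A : g →ₗ[ℝ] g) : Prop :=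
  ∀ y ∈ m B a, A y ∈ m B a ∧ ⁅a, A y⁆ = y

lemma exists_isAdInverse [FiniteDimensional ℝ g] (hB : IsInvariantInner B) (a : g) :
    ∃ A, IsAdInverse B a A := by
  let f : m B a →ₗ[ℝ] m B a :=
    (LieAlgebra.ad ℝ g a : g →ₗ[ℝ] g).restrict fun y _ => lie_self_mem_m hB y
  have hf : Function.Injective f := fun y y' h =>
    Subtype.ext (eq_of_lie_eq hB y.2 y'.2 (congrArg Subtype.val h))
  let e := LinearEquiv.ofInjectiveEndo f hf
  obtain ⟨A, hA⟩ := LinearMap.exists_extend ((m B a).subtype ∘ₗ e.symm.toLinearMap)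
  have hA' (y : g) (hy : y ∈ m B a) : A y = e.symm ⟨y, hy⟩ := LinearMap.congr_fun hA ⟨y, hy⟩
  refine ⟨A, fun y hy => ⟨?_, ?_⟩⟩
  · rw [hA' y hy]
    exact (e.symm ⟨y, hy⟩).2
  · rw [hA' y hy]
    exact congrArg Subtype.val (e.apply_symm_apply ⟨y, hy⟩)

section AdInverse

variable {A P : g →ₗ[ℝ] g}

lemma IsAdInverse.lie_comm (hB : IsInvariantInner B) (hA : IsAdInverse B a A) {z y : g}
    (hz : z ∈ k a) (hy : y ∈ m B a) : ⁅z, A y⁆ = A ⁅z, y⁆ := by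
  have hzy := lie_mem_m_of_mem_k hB hz hy
  refine eq_of_lie_eq hB (lie_mem_m_of_mem_k hB hz (hA y hy).1) (hA _ hzy).1 ?_
  rw [leibniz_lie, mem_k.1 hz, zero_lie, zero_add, (hA y hy).2, (hA _ hzy).2]

lemma IsAdInverse.skew (hB : IsInvariantInner B) (hA : IsAdInverse B a A) {y w : g}
    (hy : y ∈ m B a) (hw : w ∈ m B a) : B (A y) w = -B y (A w) := by
  conv_lhs => rw [← (hA w hw).2]
  conv_rhs => rw [← (hA y hy).2]
  rw [hB.inv, neg_neg]

/-- The `𝔨`-component of `[x, A y]` is symmetric in `x` and `y`. -/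
lemma IsAdInverse.inner_lie_symm (hB : IsInvariantInner B) (hA : IsAdInverse B a A) {z x y : g}
    (hz : z ∈ k a) (hx : x ∈ m B a) (hy : y ∈ m B a) : B z ⁅x, A y⁆ = B z ⁅y, A x⁆ := by
  have h1 := lie_mem_m_of_mem_k hB hz hx
  rw [hB.inv_right, hB.inv_right, hB.symm, hA.skew hB hy h1, ← hA.lie_comm hB hz hx, hB.symm y,
    hB.inv, neg_neg, hB.symm]

/-- Half the `𝔨`-component of `[x, A y]`, for the projection `P` to `𝔨` and the inverse `A` of `ad a`
on `𝔪`, as a bilinear map. Its diagonal `x ↦ moment P A x x` is a moment map for the action of `𝔨`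
on `𝔪` with the symplectic form `(x, y) ↦ ⟨x, A y⟩`, up to sign. -/
noncomputable def moment (P A : g →ₗ[ℝ] g) : g →ₗ[ℝ] g →ₗ[ℝ] g :=
  (2⁻¹ : ℝ) • (((LieAlgebra.ad ℝ g : g →ₗ[ℝ] g →ₗ[ℝ] g).compl₂ A).compr₂ P)

lemma moment_apply (x y : g) : moment P A x y = (2⁻¹ : ℝ) • P ⁅x, A y⁆ := rfl

lemma moment_mem_k (hP : IsOrthProj B (k a) P) (x y : g) : moment P A x y ∈ k a :=
  Submodule.smul_mem _ _ (hP _).1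

lemma inner_moment (hP : IsOrthProj B (k a) P) {z : g} (hz : z ∈ k a) (x y : g) :
    B z (moment P A x y) = 2⁻¹ * B z ⁅x, A y⁆ := by
  rw [moment_apply, map_smul, (hP _).2 z hz, smul_eq_mul]

/-- On `𝔨` the operator `ad (moment x x)` is the `𝔨`-component of `z ↦ [x, A [x, z]]`. -/
lemma inner_lie_moment (hB : IsInvariantInner B) (hP : IsOrthProj B (k a) P)
    (hA : IsAdInverse B a A) (hx : x ∈ m B a) {z w : g} (hz : z ∈ k a) (hw : w ∈ k a) :
    B w ⁅moment P A x x, z⁆ = B w ⁅x, A ⁅x, z⁆⁆ := by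
  have hxz := lie_mem_m_of_mem_m hB hz hx
  have h1 : ⁅z, ⁅x, A x⁆⁆ = -⁅⁅x, z⁆, A x⁆ - ⁅x, A ⁅x, z⁆⁆ := by
    rw [leibniz_lie, hA.lie_comm hB hz hx, ← lie_skew z x, map_neg, neg_lie, lie_neg,
      sub_eq_add_neg]
  rw [← lie_skew, map_neg, hB.inv_right, inner_moment hP (lie_mem_k hw hz), ← hB.inv_right, h1,
    map_sub, map_neg, hA.inner_lie_symm hB hw hxz hx]
  ring

/-- If `z` commutes with `moment x x`, then `A [x, z]` is in the kernel of the form on `𝔪(x)`, and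
all of the kernel arises in this way. -/
lemma map_centralizerIn_moment [FiniteDimensional ℝ g] (hB : IsInvariantInner B)
    (hP : IsOrthProj B (k a) P) (hA : IsAdInverse B a A) (hx : x ∈ m B a) :
    (centralizerIn (k a) (moment P A x x)).map
        (A ∘ₗ (LieAlgebra.ad ℝ g x : g →ₗ[ℝ] g)) =
      (LinearMap.ker ((siForm B a).restrict (mAt B a x))).map (mAt B a x).subtype := by
  apply le_antisymm
  · rintro _ ⟨z, ⟨hz, hcz⟩, rfl⟩
    change A ⁅x, z⁆ ∈ _
    have hcz' : ⁅moment P A x x, z⁆ = 0 := hcz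
    have hxz := lie_mem_m_of_mem_m hB hz hx
    have hmem : A ⁅x, z⁆ ∈ mAt B a x := by
      refine mem_mAt.2 ⟨(hA _ hxz).1, mem_m.2 fun w hw => ?_⟩
      rw [← inner_lie_moment hB hP hA hx hz hw, hcz', map_zero]
    refine ⟨⟨_, hmem⟩, LinearMap.mem_ker.2 (LinearMap.ext fun y => ?_), rfl⟩
    change -B a ⁅A ⁅x, z⁆, (y : g)⁆ = 0
    rw [hB.inv_right, (hA _ hxz).2, hB.inv, mem_m.1 (mem_mAt.1 y.2).2 z hz, neg_zero, neg_zero]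
  · rintro _ ⟨⟨y, hy⟩, hker, rfl⟩
    obtain ⟨hym, hxy⟩ := mem_mAt.1 hy
    -- `[a, y] ∈ 𝔪` is orthogonal to `𝔪(x)`, the orthogonal complement of `[x, 𝔨]` in `𝔪`.
    have hmem : ⁅a, y⁆ ∈ (k a).map (LieAlgebra.ad ℝ g x : g →ₗ[ℝ] g) := by
      obtain ⟨Q, hQ⟩ := exists_isOrthProj hB ((k a).map (LieAlgebra.ad ℝ g x : g →ₗ[ℝ] g))
      have hle : (k a).map (LieAlgebra.ad ℝ g x : g →ₗ[ℝ] g) ≤ m B a := by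
        rintro _ ⟨z, hz, rfl⟩
        exact lie_mem_m_of_mem_m hB hz hx
      set t := ⁅a, y⁆ - Q ⁅a, y⁆ with ht
      have hort (s : g) (hs : s ∈ (k a).map (LieAlgebra.ad ℝ g x : g →ₗ[ℝ] g)) : B s t = 0 := by
        rw [ht, map_sub, (hQ _).2 s hs, sub_self]
      have htm : t ∈ m B a := sub_mem (lie_self_mem_m hB y) (hle (hQ _).1)
      have htx : t ∈ mAt B a x := by
        refine mem_mAt.2 ⟨htm, mem_m.2 fun z hz => ?_⟩
        have h := hort ⁅x, z⁆ ⟨z, hz, rfl⟩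
        rwa [hB.inv, neg_eq_zero] at h
      have hyt : B ⁅a, y⁆ t = 0 := by
        have h : -B a ⁅y, t⁆ = 0 := LinearMap.congr_fun (LinearMap.mem_ker.1 hker) ⟨t, htx⟩
        rwa [neg_eq_zero, hB.inv_right] at h
      have ht0 : t = 0 := by
        apply hB.eq_zero
        calc B t t = B ⁅a, y⁆ t - B (Q ⁅a, y⁆) t := by
              rw [← LinearMap.sub_apply, ← map_sub]
          _ = 0 := by rw [hyt, hort _ (hQ _).1, sub_zero]
      rw [sub_eq_zero.1 ht0]
      exact (hQ _).1
    obtain ⟨z, hz, hzy⟩ := hmem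
    have hzy' : ⁅x, z⁆ = ⁅a, y⁆ := hzy
    have hxz := lie_mem_m_of_mem_m hB hz hx
    have hAy : A ⁅x, z⁆ = y := eq_of_lie_eq hB (hA _ hxz).1 hym (by rw [(hA _ hxz).2, hzy'])
    refine ⟨z, mem_centralizerIn.2 ⟨hz, ?_⟩, hAy⟩
    refine hB.eq_zero ?_
    have hck := lie_mem_k (moment_mem_k (A := A) hP x x) hz
    rw [inner_lie_moment hB hP hA hx hz hck, hAy, mem_m.1 hxy _ hck]

/-- The dimension of the complex kernel of the form at `x` is `dim 𝔨^c - dim 𝔨^x` for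
`c = moment x x`. -/
lemma finrank_ker_Bsi_add [FiniteDimensional ℝ g] (hB : IsInvariantInner B)
    (hP : IsOrthProj B (k a) P) (hA : IsAdInverse B a A) (hx : x ∈ m B a) :
    finrank ℂ (LinearMap.ker (Bsi B a x)) + finrank ℝ (centralizerIn (k a) x) =
      finrank ℝ (centralizerIn (k a) (moment P A x x)) := by
  rw [Bsi, finrank_ker_baseChange, ← Submodule.finrank_map_subtype_eq,
    ← map_centralizerIn_moment hB hP hA hx]
  set K := centralizerIn (k a) (moment P A x x)
  set f := A ∘ₗ (LieAlgebra.ad ℝ g x : g →ₗ[ℝ] g)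
  have hfz (z : g) : f z = A ⁅x, z⁆ := rfl
  have hker : (LinearMap.ker (f.domRestrict K)).map K.subtype = centralizerIn (k a) x := by
    ext z
    constructor
    · rintro ⟨⟨z, hz⟩, hzf, rfl⟩
      have hzk := (mem_centralizerIn.1 hz).1
      refine mem_centralizerIn.2 ⟨hzk, ?_⟩
      have h0 : A ⁅x, z⁆ = 0 := hzf
      change ⁅x, z⁆ = 0
      rw [← (hA _ (lie_mem_m_of_mem_m hB hzk hx)).2, h0, lie_zero]
    · intro hz
      obtain ⟨hzk, hxz⟩ := mem_centralizerIn.1 hz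
      have hzK : z ∈ K := by
        refine mem_centralizerIn.2 ⟨hzk, hB.eq_zero ?_⟩
        rw [inner_lie_moment hB hP hA hx hzk (lie_mem_k (moment_mem_k hP x x) hzk), hxz, map_zero,
          lie_zero, map_zero]
      refine ⟨⟨z, hzK⟩, ?_, rfl⟩
      change A ⁅x, z⁆ = 0
      rw [hxz, map_zero]
  rw [← hker, Submodule.finrank_map_subtype_eq, ← LinearMap.range_domRestrict]
  exact (f.domRestrict K).finrank_range_add_finrank_ker

end AdInverse

/-! ### The rank of `𝔨` and the criterion for `Q_a(𝔪)` -/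

lemma finrank_ker_ad_centralizer (α : centralizer a) :
    finrank ℝ (LinearMap.ker (LieAlgebra.ad ℝ (centralizer a) α :
      centralizer a →ₗ[ℝ] centralizer a)) = finrank ℝ (centralizerIn (k a) (α : g)) := by
  have hmap : (LinearMap.ker (LieAlgebra.ad ℝ (centralizer a) α :
      centralizer a →ₗ[ℝ] centralizer a)).map ((centralizer a).incl : centralizer a →ₗ[ℝ] g) =
      centralizerIn (k a) (α : g) := by
    ext z
    constructor
    · rintro ⟨u, hu, rfl⟩
      exact mem_centralizerIn.2 ⟨u.2, congrArg Subtype.val hu⟩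
    · rintro ⟨hz, hαz⟩
      exact ⟨⟨z, hz⟩, Subtype.ext hαz, rfl⟩
  rw [← hmap]
  exact (Submodule.equivMapOfInjective ((centralizer a).incl : centralizer a →ₗ[ℝ] g)
    Subtype.val_injective _).finrank_eq

lemma IsInvariantInner.restrict (hB : IsInvariantInner B) (L : LieSubalgebra ℝ g) :
    IsInvariantInner (B.compl₁₂ (L.incl : L →ₗ[ℝ] g) (L.incl : L →ₗ[ℝ] g)) where
  symm u v := hB.symm u v
  pos u hu := hB.pos u fun h => hu (Subtype.ext h)
  inv u v w := hB.inv u v w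

lemma isRegularInK_iff [FiniteDimensional ℝ g] (hB : IsInvariantInner B) {α : g} (hα : α ∈ k a) :
    IsRegularInK a α ↔ LieAlgebra.IsRegular ℝ (⟨α, hα⟩ : centralizer a) := by
  rw [LieAlgebra.isRegular_iff_finrank_engel_eq_rank,
    finrank_engel_eq (hB.restrict (centralizer a)), finrank_ker_ad_centralizer]
  exact ⟨fun h => h.2, fun h => ⟨hα, h⟩⟩

lemma minDim_le_finrank {V p : Submodule ℝ g} (hx : x ∈ p) :
    minDim V p ≤ finrank ℝ (centralizerIn V x) :=
  ciInf_le (OrderBot.bddBelow (Set.range fun y : p => finrank ℝ (centralizerIn V (y : g)))) ⟨x, hx⟩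

/-- Minimality of `dim 𝔤^x` among `x ∈ 𝔪` forces `[𝔤^x, 𝔤^x] ⊆ 𝔨^x`. If this is central, it is
both in the centre and in the derived algebra, hence zero. -/
lemma lie_eq_zero_of_mem_R [FiniteDimensional ℝ g] (hB : IsInvariantInner B)
    (hx : x ∈ R ⊤ (k a) (m B a))
    (hxc : centralizerIn (k a) x = (LieAlgebra.center ℝ g).toSubmodule) {z w : g}
    (hz : ⁅x, z⁆ = 0) (hw : ⁅x, w⁆ = 0) : ⁅z, w⁆ = 0 := by
  obtain ⟨hxm, hxq, -⟩ := hx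
  have hrange (y : g) (hy : y ∈ m B a) :
      ⁅y, z⁆ ∈ LinearMap.range (LieAlgebra.ad ℝ g x : g →ₗ[ℝ] g) := by
    refine apply_mem_range_of_finrank_ker_le (LieAlgebra.ad ℝ g x : g →ₗ[ℝ] g)
      (LieAlgebra.ad ℝ g y : g →ₗ[ℝ] g) (fun t => ?_) hz
    rw [← centralizerIn_top, hxq]
    have h := minDim_le_finrank (V := ⊤) (add_mem hxm (Submodule.smul_mem _ t hy))
    rwa [centralizerIn_top, map_add, map_smul] at h
  have hk : ⁅z, w⁆ ∈ k a := by
    refine mem_of_forall_orthogonal hB fun y hy => ?_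
    obtain ⟨v, hv⟩ := hrange y (mem_m.2 hy)
    have hv' : ⁅x, v⁆ = ⁅y, z⁆ := hv
    rw [hB.symm, hB.inv_right, ← hv', hB.inv, hw, map_zero, neg_zero]
  have hcent : ⁅z, w⁆ ∈ (LieAlgebra.center ℝ g).toSubmodule := by
    rw [← hxc]
    refine mem_centralizerIn.2 ⟨hk, ?_⟩
    rw [leibniz_lie, hz, hw, zero_lie, lie_zero, add_zero]
  have hcomm : ⁅⁅z, w⁆, z⁆ = 0 := by
    rw [← lie_skew, (LieModule.mem_maxTrivSubmodule ℝ g g _).1 hcent z, neg_zero]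
  apply hB.eq_zero
  rw [hB.inv_right, hcomm, map_zero, LinearMap.zero_apply]

/-- If `𝔤^x` is abelian, then `rank 𝔤^a = dim 𝔤^x`: some automorphism moves `x` into `𝔤^a`, and
then `𝔤^x` into an abelian centralizer containing `a`. -/
lemma rank_centralizer_eq [FiniteDimensional ℝ g] (hB : IsInvariantInner B) (a : g)
    (hab : ∀ z w : g, ⁅x, z⁆ = 0 → ⁅x, w⁆ = 0 → ⁅z, w⁆ = 0) :
    LieAlgebra.rank ℝ (centralizer a) = finrank ℝ (centralizerIn ⊤ x) := by
  obtain ⟨φ, hφ⟩ := exists_lieEquiv_lie_eq_zero hB x a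
  have hφ' : ⁅a, φ x⁆ = 0 := by rw [← lie_skew, hφ, neg_zero]
  have hpull (u : g) (hu : ⁅φ x, u⁆ = 0) : ⁅x, φ.symm u⁆ = 0 := by
    have h := φ.symm.map_lie (φ x) u
    rw [φ.symm_apply_apply, hu] at h
    rw [← h]
    exact map_zero φ.symm.toLinearEquiv
  have hcomm (u v : g) (hu : ⁅φ x, u⁆ = 0) (hv : ⁅φ x, v⁆ = 0) : ⁅u, v⁆ = 0 := by
    have h := φ.map_lie (φ.symm u) (φ.symm v)
    rw [hab _ _ (hpull u hu) (hpull v hv), φ.apply_symm_apply, φ.apply_symm_apply] at h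
    rw [← h]
    exact map_zero φ.toLinearEquiv
  have hmap : centralizerIn (k a) (φ x) =
      (centralizerIn ⊤ x).map (φ.toLinearEquiv : g →ₗ[ℝ] g) := by
    ext u
    constructor
    · rintro ⟨-, hu⟩
      exact ⟨φ.symm u, mem_centralizerIn.2 ⟨trivial, hpull u hu⟩, φ.apply_symm_apply u⟩
    · rintro ⟨z, ⟨-, hz⟩, rfl⟩
      have hz' : ⁅φ x, φ z⁆ = 0 := by
        have hxz : ⁅x, z⁆ = 0 := hz
        rw [← φ.map_lie, hxz]
        exact map_zero φ.toLinearEquiv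
      exact mem_centralizerIn.2 ⟨hcomm a (φ z) hφ hz', hz'⟩
  rw [rank_eq_finrank_centralizer (hB.restrict (centralizer a)) ⟨φ x, hφ'⟩
    (fun u v hu hv => Subtype.ext (hcomm u v (congrArg Subtype.val hu) (congrArg Subtype.val hv))),
    finrank_ker_ad_centralizer, hmap, φ.toLinearEquiv.finrank_map_eq]

/-- A point `x ∈ R(𝔪)` lies in `Q_a(𝔪)` if and only if `moment x x` is regular in `𝔨`, provided
`rank 𝔨 = q(𝔪)`. -/
lemma mem_Q_iff [FiniteDimensional ℝ g] (hB : IsInvariantInner B) {A P : g →ₗ[ℝ] g}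
    (hP : IsOrthProj B (k a) P) (hA : IsAdInverse B a A)
    (hrank : LieAlgebra.rank ℝ (centralizer a) = minDim ⊤ (m B a))
    (hx : x ∈ R ⊤ (k a) (m B a)) : x ∈ Q B a ↔ IsRegularInK a (moment P A x x) := by
  have h := finrank_ker_Bsi_add hB hP hA hx.1
  have hle := minDim_le (k a) (m B a)
  have hp := hx.2.2
  constructor
  · rintro ⟨-, hQ⟩
    refine ⟨moment_mem_k hP x x, ?_⟩
    rw [r] at hQ
    omega
  · rintro ⟨-, hreg⟩
    refine ⟨hx, ?_⟩
    rw [r]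
    omega

variable {σ : g ≃ₗ⁅ℝ⁆ g}

/-! ### The involution -/

lemma mem_gTilde {x : g} : x ∈ gTilde σ ↔ σ x = x := by
  rw [gTilde, LinearMap.mem_ker, LinearMap.sub_apply, sub_eq_zero]
  exact eq_comm

lemma mem_mTilde {x : g} : x ∈ mTilde B σ a ↔ x ∈ m B a ∧ σ x = x := by
  rw [mTilde, Submodule.mem_inf, mem_gTilde]

lemma mem_kPrime (hσ : ∀ x : g, σ (σ x) = x) (hσk : ∀ z ∈ k a, σ z ∈ k a) {x : g} :
    x ∈ kPrime σ a ↔ x ∈ k a ∧ σ x = -x := by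
  constructor
  · rintro ⟨z, hz, rfl⟩
    change z - σ z ∈ k a ∧ σ (z - σ z) = -(z - σ z)
    have h : σ (z - σ z) = σ z - σ (σ z) := map_sub σ.toLinearEquiv z (σ z)
    exact ⟨sub_mem hz (hσk z hz), by rw [h, hσ, neg_sub]⟩
  · rintro ⟨hx, hσx⟩
    refine ⟨(2⁻¹ : ℝ) • x, Submodule.smul_mem _ _ hx, ?_⟩
    change (2⁻¹ : ℝ) • x - σ.toLinearEquiv ((2⁻¹ : ℝ) • x) = x
    rw [map_smul]
    change (2⁻¹ : ℝ) • x - (2⁻¹ : ℝ) • σ x = x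
    rw [hσx]
    module

lemma map_mem_k (ha : σ a = -a) {z : g} (hz : z ∈ k a) : σ z ∈ k a := by
  have h := σ.map_lie a z
  rw [mem_k.1 hz, ha, neg_lie] at h
  rw [mem_k, ← neg_eq_zero, ← h]
  exact map_zero σ.toLinearEquiv

lemma map_mem_center {z : g} (hz : z ∈ LieAlgebra.center ℝ g) : σ z ∈ LieAlgebra.center ℝ g := by
  rw [LieModule.mem_maxTrivSubmodule] at hz ⊢
  intro x
  have h := σ.map_lie (σ.symm x) z
  rw [hz, σ.apply_symm_apply] at h
  rw [← h]
  exact map_zero σ.toLinearEquiv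

lemma inner_map_left (hσ : ∀ x : g, σ (σ x) = x) (hBσ : ∀ x y : g, B (σ x) (σ y) = B x y)
    (x y : g) : B (σ x) y = B x (σ y) := by
  rw [← hBσ x, hσ]

lemma map_mem_m (hσ : ∀ x : g, σ (σ x) = x) (hBσ : ∀ x y : g, B (σ x) (σ y) = B x y)
    (ha : σ a = -a) {y : g} (hy : y ∈ m B a) : σ y ∈ m B a :=
  mem_m.2 fun z hz => by
    rw [← inner_map_left hσ hBσ, mem_m.1 hy _ (map_mem_k ha hz)]

/-- The orthogonal projection onto a `σ`-stable subspace commutes with `σ`. -/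
lemma IsOrthProj.map_apply (hB : IsInvariantInner B) (hσ : ∀ x : g, σ (σ x) = x)
    (hBσ : ∀ x y : g, B (σ x) (σ y) = B x y) {K : Submodule ℝ g} (hK : ∀ z ∈ K, σ z ∈ K)
    {P : g →ₗ[ℝ] g} (hP : IsOrthProj B K P) (u : g) : P (σ u) = σ (P u) :=
  hP.eq_of_mem hB (hK _ (hP u).1) fun z hz => by
    rw [← inner_map_left hσ hBσ, ← inner_map_left hσ hBσ, (hP u).2 _ (hK z hz)]

/-- As `σ a = -a`, the inverse of `ad a` anticommutes with `σ`. -/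
lemma IsAdInverse.map_apply (hB : IsInvariantInner B) (hσ : ∀ x : g, σ (σ x) = x)
    (hBσ : ∀ x y : g, B (σ x) (σ y) = B x y) (ha : σ a = -a) {A : g →ₗ[ℝ] g}
    (hA : IsAdInverse B a A) {y : g} (hy : y ∈ m B a) : A (σ y) = -σ (A y) := by
  have hσy := map_mem_m hσ hBσ ha hy
  refine eq_of_lie_eq hB (hA _ hσy).1 (neg_mem (map_mem_m hσ hBσ ha (hA y hy).1)) ?_
  have h := σ.map_lie a (A y)
  rw [(hA y hy).2, ha, neg_lie] at h
  rw [(hA _ hσy).2, lie_neg, h]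

/-- On fixed points of `σ` the moment map takes values in the `-1`-eigenspace. -/
lemma map_moment (hB : IsInvariantInner B) (hσ : ∀ x : g, σ (σ x) = x)
    (hBσ : ∀ x y : g, B (σ x) (σ y) = B x y) (ha : σ a = -a) {A P : g →ₗ[ℝ] g}
    (hP : IsOrthProj B (k a) P) (hA : IsAdInverse B a A) {x y : g} (hx : x ∈ mTilde B σ a)
    (hy : y ∈ mTilde B σ a) : σ (moment P A x y) = -moment P A x y := by
  obtain ⟨hxm, hσx⟩ := mem_mTilde.1 hx
  obtain ⟨hym, hσy⟩ := mem_mTilde.1 hy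
  have hAy := hA.map_apply hB hσ hBσ ha hym
  rw [hσy] at hAy
  have h : σ ⁅x, A y⁆ = -⁅x, A y⁆ := by
    rw [σ.map_lie, hσx, ← neg_eq_iff_eq_neg.2 hAy, lie_neg]
  have h2 : σ (moment P A x y) = (2⁻¹ : ℝ) • σ (P ⁅x, A y⁆) :=
    map_smul σ.toLinearEquiv (2⁻¹ : ℝ) (P ⁅x, A y⁆)
  rw [h2, ← hP.map_apply hB hσ hBσ (fun z hz => map_mem_k ha hz), h, map_neg, smul_neg,
    moment_apply]

/-- The part of `𝔨'` that is orthogonal to the centre of `𝔤`; it contains the values of the moment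
map on `𝔪̃`. -/
def kPrimeOrth (B : LinearMap.BilinForm ℝ g) (σ : g ≃ₗ⁅ℝ⁆ g) (a : g) : Submodule ℝ g :=
  k a ⊓ LinearMap.ker (LinearMap.id + (σ : g →ₗ[ℝ] g)) ⊓
    B.orthogonal (LieAlgebra.center ℝ g).toSubmodule

lemma mem_kPrimeOrth {v : g} : v ∈ kPrimeOrth B σ a ↔
    v ∈ k a ∧ σ v = -v ∧ ∀ z ∈ LieAlgebra.center ℝ g, B z v = 0 := by
  rw [kPrimeOrth, Submodule.mem_inf, Submodule.mem_inf, and_assoc,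
    LinearMap.BilinForm.mem_orthogonal_iff, LinearMap.mem_ker, LinearMap.add_apply, add_comm,
    add_eq_zero_iff_eq_neg]
  rfl

lemma lie_eq_zero_of_mem_center {z : g} (hz : z ∈ LieAlgebra.center ℝ g) (x : g) : ⁅x, z⁆ = 0 :=
  (LieModule.mem_maxTrivSubmodule ℝ g g z).1 hz x

lemma moment_mem_kPrimeOrth (hB : IsInvariantInner B) (hσ : ∀ x : g, σ (σ x) = x)
    (hBσ : ∀ x y : g, B (σ x) (σ y) = B x y) (ha : σ a = -a) {A P : g →ₗ[ℝ] g}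
    (hP : IsOrthProj B (k a) P) (hA : IsAdInverse B a A) {x y : g} (hx : x ∈ mTilde B σ a)
    (hy : y ∈ mTilde B σ a) : moment P A x y ∈ kPrimeOrth B σ a := by
  refine mem_kPrimeOrth.2 ⟨moment_mem_k hP x y, map_moment hB hσ hBσ ha hP hA hx hy, fun z hz => ?_⟩
  rw [inner_moment hP (lie_eq_zero_of_mem_center hz a), hB.inv_right, ← lie_skew,
    lie_eq_zero_of_mem_center hz x, neg_zero, map_zero, LinearMap.zero_apply, mul_zero]

/-- The derivative at `x ∈ 𝔪̃` of the moment map `𝔪̃ → 𝔨'` has image the orthogonal complement in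
`𝔨'` of `𝔨^x`, as `A` maps `𝔪̃` onto the `-1`-eigenspace of `σ` in `𝔪`. -/
lemma exists_moment_add_moment [FiniteDimensional ℝ g] (hB : IsInvariantInner B)
    (hσ : ∀ x : g, σ (σ x) = x)
    (hBσ : ∀ x y : g, B (σ x) (σ y) = B x y) (ha : σ a = -a) {A P : g →ₗ[ℝ] g}
    (hP : IsOrthProj B (k a) P) (hA : IsAdInverse B a A) {x : g} (hx : x ∈ mTilde B σ a)
    (hxc : centralizerIn (k a) x = (LieAlgebra.center ℝ g).toSubmodule) {v : g}
    (hv : v ∈ kPrimeOrth B σ a) : ∃ w ∈ mTilde B σ a, moment P A x w + moment P A w x = v := by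
  obtain ⟨hxm, hσx⟩ := mem_mTilde.1 hx
  let D : g →ₗ[ℝ] g := moment P A x + (moment P A).flip x
  suffices hmem : v ∈ (mTilde B σ a).map D by
    obtain ⟨w, hw, hwv⟩ := hmem
    exact ⟨w, hw, hwv⟩
  obtain ⟨Q, hQ⟩ := exists_isOrthProj hB ((mTilde B σ a).map D)
  have hle : (mTilde B σ a).map D ≤ kPrimeOrth B σ a := by
    rintro _ ⟨w, hw, rfl⟩
    exact add_mem (moment_mem_kPrimeOrth hB hσ hBσ ha hP hA hx hw)
      (moment_mem_kPrimeOrth hB hσ hBσ ha hP hA hw hx)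
  -- The component `t` of `v` orthogonal to the image commutes with `x`, hence is central.
  set t := v - Q v with ht
  have htF : t ∈ kPrimeOrth B σ a := sub_mem hv (hle (hQ v).1)
  obtain ⟨htk, hσt, htc⟩ := mem_kPrimeOrth.1 htF
  have htx := lie_mem_m_of_mem_k hB htk hxm
  have hlie : ⁅t, x⁆ = 0 := by
    apply hB.eq_zero
    -- Pair `t` with the derivative in the direction `w = [a, [t, x]]`, for which `A w = [t, x]`.
    have hw : ⁅a, ⁅t, x⁆⁆ ∈ mTilde B σ a := by
      refine mem_mTilde.2 ⟨lie_self_mem_m hB _, ?_⟩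
      rw [σ.map_lie, σ.map_lie, ha, hσt, hσx, neg_lie, neg_lie, lie_neg, neg_neg]
    obtain ⟨hwm, -⟩ := mem_mTilde.1 hw
    have hAw : A ⁅a, ⁅t, x⁆⁆ = ⁅t, x⁆ := eq_of_lie_eq hB (hA _ hwm).1 htx (hA _ hwm).2
    have h : B t (D ⁅a, ⁅t, x⁆⁆) = 0 := by
      rw [hB.symm, ht, map_sub, (hQ v).2 _ ⟨_, hw, rfl⟩, sub_self]
    have h2 : B t (D ⁅a, ⁅t, x⁆⁆) = B t ⁅x, A ⁅a, ⁅t, x⁆⁆⁆ := by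
      change B t (moment P A x _ + moment P A _ x) = _
      rw [map_add, inner_moment hP htk, inner_moment hP htk, hA.inner_lie_symm hB htk hwm hxm]
      ring
    rw [h, hAw, hB.inv_right] at h2
    exact h2.symm
  have htc' : t ∈ LieAlgebra.center ℝ g := by
    change t ∈ (LieAlgebra.center ℝ g).toSubmodule
    rw [← hxc]
    exact mem_centralizerIn.2 ⟨htk, by rw [← lie_skew, hlie, neg_zero]⟩
  have ht0 : t = 0 := hB.eq_zero (htc t htc')
  rw [sub_eq_zero.1 ht0]
  exact (hQ v).1

/-- Subtracting the central component of a regular element of `𝔨'` gives a regular element of `𝔨'`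
orthogonal to the centre of `𝔤`. -/
lemma exists_regular_mem_kPrimeOrth [FiniteDimensional ℝ g] (hB : IsInvariantInner B)
    (hσ : ∀ x : g, σ (σ x) = x) (hBσ : ∀ x y : g, B (σ x) (σ y) = B x y) {α : g}
    (hαk : α ∈ k a) (hσα : σ α = -α) (hα : IsRegularInK a α) :
    ∃ β ∈ kPrimeOrth B σ a, IsRegularInK a β := by
  obtain ⟨Q, hQ⟩ := exists_isOrthProj hB (LieAlgebra.center ℝ g).toSubmodule
  have hQc (u : g) : Q u ∈ LieAlgebra.center ℝ g := (hQ u).1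
  have hQk (u : g) : Q u ∈ k a := lie_eq_zero_of_mem_center (hQc u) a
  have hσQ : σ (Q α) = -Q α := by
    rw [← hQ.map_apply hB hσ hBσ (fun z hz => map_mem_center hz), hσα, map_neg]
  refine ⟨α - Q α, mem_kPrimeOrth.2 ⟨sub_mem hαk (hQk α), ?_, fun z hz => ?_⟩,
    sub_mem hαk (hQk α), ?_⟩
  · have h : σ (α - Q α) = σ α - σ (Q α) := map_sub σ.toLinearEquiv α (Q α)
    rw [h, hσα, hσQ]
    abel
  · rw [map_sub, (hQ α).2 z hz, sub_self]
  · have heq : centralizerIn (k a) (α - Q α) = centralizerIn (k a) α := by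
      ext z
      rw [mem_centralizerIn, mem_centralizerIn, sub_lie, ← lie_skew (Q α) z,
        lie_eq_zero_of_mem_center (hQc α), neg_zero, sub_zero]
    rw [heq, hα.2]

/-- If `x₀ ∈ R(𝔪) ∩ 𝔪̃` has `𝔨^{x₀} = 𝔷(𝔤)` and `𝔨'` contains a regular element `α` of `𝔨`
orthogonal to the centre, then the moment map takes a regular value `moment x₀ x₀ + t α` at some
`x ∈ R(𝔪) ∩ 𝔪̃` near `x₀`. -/
lemma exists_regular_moment [FiniteDimensional ℝ g] (hB : IsInvariantInner B)
    (hσ : ∀ x : g, σ (σ x) = x) (hBσ : ∀ x y : g, B (σ x) (σ y) = B x y) (ha : σ a = -a)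
    {A P : g →ₗ[ℝ] g} (hP : IsOrthProj B (k a) P) (hA : IsAdInverse B a A) {x₀ : g}
    (hx₀ : x₀ ∈ R ⊤ (k a) (m B a)) (hx₀σ : x₀ ∈ mTilde B σ a)
    (hx₀c : centralizerIn (k a) x₀ = (LieAlgebra.center ℝ g).toSubmodule) {α : g}
    (hα : α ∈ kPrimeOrth B σ a) (hαreg : IsRegularInK a α) :
    ∃ x ∈ R ⊤ (k a) (m B a), x ∈ mTilde B σ a ∧ IsRegularInK a (moment P A x x) := by
  let β : mTilde B σ a →ₗ[ℝ] mTilde B σ a →ₗ[ℝ] kPrimeOrth B σ a :=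
    LinearMap.mk₂ ℝ (fun x y => ⟨moment P A x y,
        moment_mem_kPrimeOrth hB hσ hBσ ha hP hA x.2 y.2⟩)
      (fun _ _ _ => Subtype.ext (by simp)) (fun _ _ _ => Subtype.ext (by simp))
      (fun _ _ _ => Subtype.ext (by simp)) (fun _ _ _ => Subtype.ext (by simp))
  let Λ : mTilde B σ a →ₗ[ℝ] g →ₗ[ℝ] g :=
    (LieAlgebra.ad ℝ g : g →ₗ[ℝ] g →ₗ[ℝ] g) ∘ₗ (mTilde B σ a).subtype
  let Λ' : mTilde B σ a →ₗ[ℝ] k a →ₗ[ℝ] g := Λ.compl₂ (k a).subtype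
  have hΛ (x : mTilde B σ a) :
      finrank ℝ (LinearMap.ker (Λ x)) = finrank ℝ (centralizerIn ⊤ (x : g)) := by
    rw [centralizerIn_top]
    rfl
  have hΛ' (x : mTilde B σ a) :
      finrank ℝ (LinearMap.ker (Λ' x)) = finrank ℝ (centralizerIn (k a) (x : g)) := by
    have hmap : (LinearMap.ker (Λ' x)).map (k a).subtype = centralizerIn (k a) (x : g) := by
      ext z
      constructor
      · rintro ⟨u, hu, rfl⟩
        exact mem_centralizerIn.2 ⟨u.2, hu⟩
      · rintro ⟨hz, hxz⟩
        exact ⟨⟨z, hz⟩, hxz, rfl⟩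
    rw [← hmap, Submodule.finrank_map_subtype_eq]
  have hsurj (f : kPrimeOrth B σ a) : ∃ w, β ⟨x₀, hx₀σ⟩ w + β w ⟨x₀, hx₀σ⟩ = f := by
    obtain ⟨w, hw, h⟩ := exists_moment_add_moment hB hσ hBσ ha hP hA hx₀σ hx₀c f.2
    exact ⟨⟨w, hw⟩, Subtype.ext h⟩
  have hev := exists_quadratic_eq β ⟨x₀, hx₀σ⟩ hsurj Λ Λ' ⟨α, hα⟩
  have hreg := eventually_isRegular_add_smul (hB.restrict (centralizer a))
    ((isRegularInK_iff hB hαreg.1).1 hαreg) ⟨moment P A x₀ x₀, moment_mem_k hP x₀ x₀⟩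
  obtain ⟨t, ⟨x, hxβ, hx1, hx2⟩, ht⟩ := ((hev.filter_mono nhdsWithin_le_nhds).and hreg).exists
  have hxβ' : moment P A (x : g) (x : g) = moment P A x₀ x₀ + t • α := congrArg Subtype.val hxβ
  have hxm := (mem_mTilde.1 x.2).1
  rw [hΛ, hΛ] at hx1
  rw [hΛ', hΛ'] at hx2
  refine ⟨x, ⟨hxm, le_antisymm (hx1.trans hx₀.2.1.le) (minDim_le_finrank hxm),
    le_antisymm (hx2.trans hx₀.2.2.le) (minDim_le_finrank hxm)⟩, x.2, ?_⟩
  rw [hxβ']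
  exact (isRegularInK_iff hB (add_mem (moment_mem_k hP x₀ x₀)
    (Submodule.smul_mem _ t hαreg.1))).2 ht

end Suborbit

/-- `g` is a compact Lie algebra: real, finite-dimensional, with an invariant inner product `B`,
which is also preserved by the involutive automorphism `σ`. -/
theorem proposition2p10 {g : Type*} [LieRing g] [LieAlgebra ℝ g] [FiniteDimensional ℝ g]
    (B : LinearMap.BilinForm ℝ g) (hBsymm : ∀ x y : g, B x y = B y x)
    (hBpos : ∀ x : g, x ≠ 0 → 0 < B x x)
    (hBinv : ∀ x y z : g, B ⁅x, y⁆ z = -B y ⁅x, z⁆)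
    (σ : g ≃ₗ⁅ℝ⁆ g) (hσ : ∀ x : g, σ (σ x) = x)
    (hBσ : ∀ x y : g, B (σ x) (σ y) = B x y)
    (a : g) (ha : σ a = -a)
    (hne : (Suborbit.R ⊤ (Suborbit.k a) (Suborbit.m B a) ∩
      (Suborbit.mTilde B σ a : Set g)).Nonempty)
    (x₀ : g)
    (hx₀ : x₀ ∈ Suborbit.R ⊤ (Suborbit.k a) (Suborbit.m B a) ∩
      Suborbit.R (Suborbit.gTilde σ) (Suborbit.kTilde σ a) (Suborbit.mTilde B σ a))
    (hx₀c : Suborbit.centralizerIn (Suborbit.k a) x₀ = (LieAlgebra.center ℝ g).toSubmodule) :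
    (Suborbit.Q B a ∩ (Suborbit.mTilde B σ a : Set g)).Nonempty ↔
      ∃ α ∈ Suborbit.kPrime σ a, Suborbit.IsRegularInK a α := by
  obtain ⟨hx₀R, hx₀σ, -⟩ := hx₀
  have hB : Suborbit.IsInvariantInner B := ⟨hBsymm, hBpos, hBinv⟩
  obtain ⟨P, hP⟩ := Suborbit.exists_isOrthProj hB (Suborbit.k a)
  obtain ⟨A, hA⟩ := Suborbit.exists_isAdInverse hB a
  have hrank : LieAlgebra.rank ℝ (Suborbit.centralizer a) =
      Suborbit.minDim ⊤ (Suborbit.m B a) := by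
    rw [← hx₀R.2.1]
    exact Suborbit.rank_centralizer_eq hB a
      fun z w hz hw => Suborbit.lie_eq_zero_of_mem_R hB hx₀R hx₀c hz hw
  have hkP {α : g} := Suborbit.mem_kPrime (a := a) (x := α) hσ fun z hz => Suborbit.map_mem_k ha hz
  constructor
  · rintro ⟨x, hxQ, hxσ⟩
    exact ⟨_, hkP.2 ⟨Suborbit.moment_mem_k hP x x,
      Suborbit.map_moment hB hσ hBσ ha hP hA hxσ hxσ⟩,
      (Suborbit.mem_Q_iff hB hP hA hrank hxQ.1).1 hxQ⟩
  · rintro ⟨α, hα, hαreg⟩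
    obtain ⟨hαk, hσα⟩ := hkP.1 hα
    obtain ⟨α', hα', hα'reg⟩ :=
      Suborbit.exists_regular_mem_kPrimeOrth hB hσ hBσ hαk hσα hαreg
    obtain ⟨x, hxR, hxσ, hx⟩ := Suborbit.exists_regular_moment hB hσ hBσ ha hP hA hx₀R hx₀σ hx₀c
      hα' hα'reg
    exact ⟨x, (Suborbit.mem_Q_iff hB hP hA hrank hxR).2 hx, hxσ⟩
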